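/- All graphs are finite, simple and undirected. Two distinct vertices $u,v$ of a graph $G$ are twins if $N(u)=N(v)$ or $N[u]=N[v]$, where $N(v)$ is the open and $N[v]=N(v)\cup\{v\}$ the closed neighborhood; $G$ is twin-free if it has no twins. A set $D$ of vertices is dominating if every vertex outside $D$ has a neighbor in $D$, total dominating if every vertex of $G$ has a neighbor in $D$, and locating if $N(u)\cap D\neq N(v)\cap D$ for all distinct vertices $u,v\notin D$. The location-domination number $\gamma_L(G)$ is the minimum size of a set that is both dominating and locating. For $G$ without isolated vertices, the location-total domination number $\gamma_t^L(G)$ is the minimum size of a set that is both total dominating and locating. Let $G$ be a twin-free graph of order $n$ and minimum degree $\delta\ge 1$. Then \[ \gamma_t^L(G)\le\left(\frac23+\frac{1+\ln\delta}{\delta}\right)n . \] Moreover, if $G$ is bipartite, co-bipartite (its complement is bipartite) or split (its vertex set can be partitioned into a clique and an independent set), then \[ \gamma_t^L(G)\le\left(\frac12+\frac{1+\ln\delta}{\delta}\right)n . \] Finally, if it is true that every twin-free graph $H$ without isolated vertices satisfies $\gamma_L(H)\le\frac12|V(H)|$ (a conjecture), then \[ \gamma_t^L(G)\le\left(\frac12+\frac{1+\ln\delta}{\delta}\right)n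 \] holds for every twin-free graph $G$ of order $n$ and minimum degree $\delta\ge 1$. -/

import Mathlib

universe u

namespace SimpleGraph

variable {V : Type u} (G : SimpleGraph V)

/-- Two distinct vertices with the same open neighborhood or the same closed neighborhood. -/
def AreTwins (u v : V) : Prop :=
  u ≠ v ∧ (G.neighborSet u = G.neighborSet v ∨
    insert u (G.neighborSet u) = insert v (G.neighborSet v))

/-- A graph without twins (open or closed). -/
def IsTwinFree : Prop := ∀ u v : V, ¬ G.AreTwins u v

/-- A graph in which every vertex has a neighbor. -/
def HasNoIsolatedVertex : Prop := ∀ v : V, ∃ w : V, G.Adj v w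

/-- Every vertex outside `D` has a neighbor in `D`. -/
def IsDominatingSet (D : Finset V) : Prop := ∀ v : V, v ∉ D → ∃ w ∈ D, G.Adj v w

/-- Every vertex of the graph has a neighbor in `D`. -/
def IsTotalDominatingSet (D : Finset V) : Prop := ∀ v : V, ∃ w ∈ D, G.Adj v w

/-- Distinct vertices outside `D` have distinct neighborhoods within `D`. -/
def IsLocatingSet (D : Finset V) : Prop :=
  ∀ u v : V, u ∉ D → v ∉ D → u ≠ v →
    G.neighborSet u ∩ (D : Set V) ≠ G.neighborSet v ∩ (D : Set V)

def IsLocatingDominatingSet (D : Finset V) : Prop :=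
  G.IsDominatingSet D ∧ G.IsLocatingSet D

def IsLocatingTotalDominatingSet (D : Finset V) : Prop :=
  G.IsTotalDominatingSet D ∧ G.IsLocatingSet D

/-- The location-domination number: the minimum size of a locating-dominating set. -/
noncomputable def locationDominationNumber : ℕ :=
  sInf {k : ℕ | ∃ D : Finset V, G.IsLocatingDominatingSet D ∧ D.card = k}

/-- The location-total domination number: the minimum size of a locating-total dominating set. -/
noncomputable def locationTotalDominationNumber : ℕ :=
  sInf {k : ℕ | ∃ D : Finset V, G.IsLocatingTotalDominatingSet D ∧ D.card = k}

/-- In a finite graph the location-domination number is attained, hence a genuine minimum. -/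
theorem exists_isLocatingDominatingSet_card_eq [Fintype V] :
    ∃ D : Finset V, G.IsLocatingDominatingSet D ∧ D.card = G.locationDominationNumber :=
  Nat.sInf_mem (s := {k : ℕ | ∃ D : Finset V, G.IsLocatingDominatingSet D ∧ D.card = k})
    ⟨_, Finset.univ, ⟨fun v hv => absurd (Finset.mem_univ v) hv,
      fun u _ hu => absurd (Finset.mem_univ u) hu⟩, rfl⟩

/-- In a finite graph without isolated vertices the location-total domination number is attained,
hence a genuine minimum. -/
theorem exists_isLocatingTotalDominatingSet_card_eq [Fintype V] (h : G.HasNoIsolatedVertex) :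
    ∃ D : Finset V, G.IsLocatingTotalDominatingSet D ∧
      D.card = G.locationTotalDominationNumber :=
  Nat.sInf_mem (s := {k : ℕ | ∃ D : Finset V, G.IsLocatingTotalDominatingSet D ∧ D.card = k})
    ⟨_, Finset.univ, ⟨fun v => (h v).imp fun w hw => ⟨Finset.mem_univ w, hw⟩,
      fun u _ hu => absurd (Finset.mem_univ u) hu⟩, rfl⟩

/-- The complement is bipartite, that is, the vertices can be covered by two cliques. -/
def IsCoBipartite : Prop := Gᶜ.IsBipartite

/-- The vertex set can be partitioned into a clique and an independent set. -/
def IsSplit : Prop := ∃ K : Set V, G.IsClique K ∧ G.IsIndepSet Kᶜ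

end SimpleGraph

/-- The conjecture on locating-dominating sets: every finite twin-free graph of order `n` without
isolated vertices has location-domination number at most `n / 2`. -/
def LocationDominationConjecture : Prop :=
  ∀ (W : Type u) [Fintype W] (H : SimpleGraph W), H.IsTwinFree → H.HasNoIsolatedVertex →
    (H.locationDominationNumber : ℝ) ≤ (Fintype.card W : ℝ) / 2

namespace SimpleGraph

/-! ### Locating sets. -/

section Locating

variable {V : Type u} {G : SimpleGraph V}

/-! Location survives enlarging a set, so the union of a locating set with a total dominating set
bounds the number (`IsLocatingSet.locationTotalDominationNumber_le`). Random sampling with repair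
gives the total dominating set. A locating set need not dominate, so only its size matters: 2/3 of
the order by an extremal argument on traces, 1/2 in the special classes, and 1/2 under the
conjecture by forgetting domination. -/

theorem IsTwinFree.exists_separating (hG : G.IsTwinFree) {u v : V} (huv : u ≠ v) :
    ∃ z, z ≠ u ∧ z ≠ v ∧ ¬ (G.Adj u z ↔ G.Adj v z) := by
  by_contra! h
  apply hG u v
  refine ⟨huv, ?_⟩
  by_cases hadj : G.Adj u v
  · right
    ext z
    simp only [Set.mem_insert_iff, mem_neighborSet]
    rcases eq_or_ne z u with rfl | hu
    · simp [hadj.symm]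
    rcases eq_or_ne z v with rfl | hv
    · simp [hadj]
    simp [hu, hv, h z hu hv]
  · left
    ext z
    simp only [mem_neighborSet]
    rcases eq_or_ne z u with rfl | hu
    · simp [G.adj_comm v, hadj]
    rcases eq_or_ne z v with rfl | hv
    · simp [hadj]
    exact h z hu hv

theorem isLocatingSet_of_exists {D : Finset V}
    (h : ∀ u v, u ∉ D → v ∉ D → u ≠ v → ∃ z ∈ D, ¬ (G.Adj u z ↔ G.Adj v z)) :
    G.IsLocatingSet D := by
  intro u v hu hv huv heq
  obtain ⟨z, hz, hne⟩ := h u v hu hv huv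
  have := Set.ext_iff.1 heq z
  simp only [Set.mem_inter_iff, mem_neighborSet, Finset.mem_coe, hz, and_true] at this
  exact hne this

theorem IsLocatingSet.mono {D E : Finset V} (h : G.IsLocatingSet D) (hDE : D ⊆ E) :
    G.IsLocatingSet E := by
  intro u v hu hv huv heq
  refine h u v (fun h' => hu (hDE h')) (fun h' => hv (hDE h')) huv ?_
  have hE : (D : Set V) = (E : Set V) ∩ D :=
    (Set.inter_eq_right.2 (Finset.coe_subset.2 hDE)).symm
  rw [hE, ← Set.inter_assoc, ← Set.inter_assoc, heq]

/-- Twin-freeness supplies a separator distinct from both vertices, and homogeneity outside `D`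
forces it into `D`. -/
theorem isLocatingSet_of_homogeneous_compl (hG : G.IsTwinFree) {D : Finset V}
    (h : ∀ u v z, u ∉ D → v ∉ D → z ∉ D → z ≠ u → z ≠ v → (G.Adj u z ↔ G.Adj v z)) :
    G.IsLocatingSet D := by
  refine isLocatingSet_of_exists fun u v hu hv huv => ?_
  obtain ⟨z, hzu, hzv, hz⟩ := hG.exists_separating huv
  exact ⟨z, by_contra fun hzD => hz (h u v z hu hv hzD hzu hzv), hz⟩

theorem isLocatingSet_of_compl_isIndepSet (hG : G.IsTwinFree) {D : Finset V}
    (h : G.IsIndepSet ((D : Set V)ᶜ)) : G.IsLocatingSet D :=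
  isLocatingSet_of_homogeneous_compl hG fun _ _ _ hu hv hz hzu hzv =>
    iff_of_false (h (by simpa using hu) (by simpa using hz) hzu.symm)
      (h (by simpa using hv) (by simpa using hz) hzv.symm)

theorem isLocatingSet_of_compl_isClique (hG : G.IsTwinFree) {D : Finset V}
    (h : G.IsClique ((D : Set V)ᶜ)) : G.IsLocatingSet D :=
  isLocatingSet_of_homogeneous_compl hG fun _ _ _ hu hv hz hzu hzv =>
    iff_of_true (h (by simpa using hu) (by simpa using hz) hzu.symm)
      (h (by simpa using hv) (by simpa using hz) hzv.symm)

theorem IsBipartite.exists_indep_cover (h : G.IsBipartite) :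
    ∃ K : Set V, G.IsIndepSet K ∧ G.IsIndepSet Kᶜ := by
  obtain ⟨c⟩ := h
  refine ⟨{v | c v = 0}, fun u hu v hv _ hadj => c.valid hadj ?_,
    fun u hu v hv _ hadj => c.valid hadj ?_⟩
  · simp only [Set.mem_ofPred_eq] at hu hv
    rw [hu, hv]
  · simp only [Set.mem_compl_iff, Set.mem_ofPred_eq] at hu hv
    omega

open Classical in
theorem filter_adj_eq_iff {D : Finset V} {u v : V} :
    D.filter (G.Adj u) = D.filter (G.Adj v) ↔ ∀ z ∈ D, (G.Adj u z ↔ G.Adj v z) := by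
  simp [Finset.ext_iff]

open Classical in
theorem filter_adj_insert_inter (D : Finset V) (z w : V) :
    (insert z D).filter (G.Adj w) ∩ D = D.filter (G.Adj w) := by
  ext a
  simp only [Finset.mem_inter, Finset.mem_filter, Finset.mem_insert]
  tauto

open Classical in
theorem isLocatingSet_of_injOn_filter_adj {D E : Finset V} (hDE : D ⊆ E)
    (h : Set.InjOn (fun v => D.filter (G.Adj v)) ((E : Set V)ᶜ)) : G.IsLocatingSet E := by
  refine isLocatingSet_of_exists fun u v hu hv huv => ?_
  by_contra! hz
  exact huv (h (by simpa using hu) (by simpa using hv)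
    (filter_adj_eq_iff.2 fun z hzD => hz z (hDE hzD)))

theorem IsLocatingSet.locationTotalDominationNumber_le {D T : Finset V}
    (hD : G.IsLocatingSet D) (hT : G.IsTotalDominatingSet T) :
    G.locationTotalDominationNumber ≤ D.card + T.card := by
  classical
  have hloc : G.IsLocatingTotalDominatingSet (D ∪ T) :=
    ⟨fun v => (hT v).imp fun w hw => ⟨Finset.mem_union_right _ hw.1, hw.2⟩,
      hD.mono Finset.subset_union_left⟩
  have hle : G.locationTotalDominationNumber ≤ (D ∪ T).card := Nat.sInf_le ⟨_, hloc, rfl⟩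
  exact hle.trans (Finset.card_union_le _ _)

variable [Fintype V]

theorem exists_isLocatingSet_of_compl (K : Set V)
    (hK : ∀ D : Finset V, (D : Set V) = K → G.IsLocatingSet D)
    (hK' : ∀ D : Finset V, (D : Set V) = Kᶜ → G.IsLocatingSet D) :
    ∃ D : Finset V, G.IsLocatingSet D ∧ 2 * D.card ≤ Fintype.card V := by
  classical
  have hcard := Finset.card_add_card_compl K.toFinset
  rcases le_total K.toFinset.card K.toFinsetᶜ.card with h | h
  · exact ⟨K.toFinset, hK _ (by simp), by omega⟩
  · exact ⟨K.toFinsetᶜ, hK' _ (by simp), by omega⟩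

theorem IsTwinFree.exists_isLocatingSet_two_mul_card_le (hG : G.IsTwinFree)
    (h : G.IsBipartite ∨ G.IsCoBipartite ∨ G.IsSplit) :
    ∃ D : Finset V, G.IsLocatingSet D ∧ 2 * D.card ≤ Fintype.card V := by
  rcases h with h | h | ⟨K, hK, hK'⟩
  · obtain ⟨K, hK, hK'⟩ := h.exists_indep_cover
    refine exists_isLocatingSet_of_compl K (fun D hD => ?_) (fun D hD => ?_)
    · exact isLocatingSet_of_compl_isIndepSet hG (by rwa [hD])
    · exact isLocatingSet_of_compl_isIndepSet hG (by rwa [hD, compl_compl])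
  · obtain ⟨K, hK, hK'⟩ := IsBipartite.exists_indep_cover h
    rw [isIndepSet_compl] at hK hK'
    refine exists_isLocatingSet_of_compl K (fun D hD => ?_) (fun D hD => ?_)
    · exact isLocatingSet_of_compl_isClique hG (by rwa [hD])
    · exact isLocatingSet_of_compl_isClique hG (by rwa [hD, compl_compl])
  · refine exists_isLocatingSet_of_compl K (fun D hD => ?_) (fun D hD => ?_)
    · exact isLocatingSet_of_compl_isIndepSet hG (by rwa [hD])
    · exact isLocatingSet_of_compl_isClique hG (by rwa [hD, compl_compl])

/-! ### Traces and the two-thirds bound. -/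

open Classical in
/-- The set of traces `N(v) ∩ D` of the vertices `v` outside `D`. -/
noncomputable def traces (G : SimpleGraph V) (D : Finset V) : Finset (Finset V) :=
  Dᶜ.image fun v => D.filter (G.Adj v)

open Classical in
/-- Adding to `D` a vertex that shares its trace does not lose traces. -/
theorem image_traces_insert {D : Finset V} {x y : V} (hy : y ∉ D) (hxy : x ≠ y)
    (h : D.filter (G.Adj x) = D.filter (G.Adj y)) :
    traces G D ⊆ (traces G (insert x D)).image (· ∩ D) := by
  intro t ht
  simp only [traces, Finset.mem_image, Finset.mem_compl] at ht
  obtain ⟨w, hw, rfl⟩ := ht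
  simp only [traces, Finset.mem_image, Finset.mem_compl, Finset.mem_insert, not_or]
  by_cases hwx : w = x
  -- The vertex `x` is no longer outside, but `y` still realizes its trace.
  · subst hwx
    exact ⟨_, ⟨y, ⟨hxy.symm, hy⟩, rfl⟩, by rw [filter_adj_insert_inter, h]⟩
  · exact ⟨_, ⟨w, ⟨hwx, hw⟩, rfl⟩, filter_adj_insert_inter ..⟩

open Classical in
theorem card_traces_le_card_traces_insert {D : Finset V} {x y : V} (hy : y ∉ D) (hxy : x ≠ y)
    (h : D.filter (G.Adj x) = D.filter (G.Adj y)) :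
    (traces G D).card ≤ (traces G (insert x D)).card :=
  (Finset.card_le_card (image_traces_insert hy hxy h)).trans Finset.card_image_le

open Classical in
/-- Adding to `D` a vertex that shares its trace and separates two vertices of equal trace creates
a new trace. -/
theorem card_traces_lt_card_traces_insert {D : Finset V} {x y u v : V} (hy : y ∉ D) (hxy : x ≠ y)
    (h : D.filter (G.Adj x) = D.filter (G.Adj y)) (hu : u ∉ insert x D) (hv : v ∉ insert x D)
    (huv : D.filter (G.Adj u) = D.filter (G.Adj v)) (hx : ¬ (G.Adj u x ↔ G.Adj v x)) :
    (traces G D).card < (traces G (insert x D)).card := by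
  refine (Finset.card_le_card (image_traces_insert hy hxy h)).trans_lt ?_
  refine Finset.card_image_le.lt_of_ne fun heq => hx ?_
  have hinj := Finset.card_image_iff.1 heq
  have hmem : ∀ w ∉ insert x D, (insert x D).filter (G.Adj w) ∈ traces G (insert x D) :=
    fun w hw => Finset.mem_image_of_mem _ (Finset.mem_compl.2 hw)
  have := hinj (hmem u hu) (hmem v hv)
    (by simp only [filter_adj_insert_inter]; exact huv)
  exact filter_adj_eq_iff.1 this x (Finset.mem_insert_self x D)

/-- Keeping one vertex of each trace outside gives a locating set. -/
theorem exists_isLocatingSet_card_add_card_traces (D : Finset V) :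
    ∃ E : Finset V, G.IsLocatingSet E ∧ E.card + (traces G D).card = Fintype.card V := by
  classical
  obtain ⟨R, hRD, hR, hinj⟩ := Finset.exists_subset_injOn_image_eq_of_surjOn
    (f := fun v => D.filter (G.Adj v)) (Dᶜ : Finset V) (traces G D)
    (by rw [traces, Finset.coe_image, Finset.coe_compl]; exact Set.surjOn_image _ _)
  refine ⟨Rᶜ, isLocatingSet_of_injOn_filter_adj (D := D)
    (Finset.subset_compl_comm.1 (by simpa [← Finset.coe_subset] using hRD))
    (by simpa using hR), ?_⟩
  rw [← hinj, Finset.card_image_of_injOn hR, add_comm, Finset.card_add_card_compl]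

/-- A twin-free graph has a locating set containing at most two thirds of the vertices. -/
theorem IsTwinFree.exists_isLocatingSet_three_mul_card_le (hG : G.IsTwinFree) [Nonempty V] :
    ∃ D : Finset V, G.IsLocatingSet D ∧ 3 * D.card ≤ 2 * Fintype.card V := by
  classical
  -- Choose `D` largest among sets with at least as many traces as elements. If `D` has a third of
  -- the vertices, one representative per trace can be left out.
  obtain ⟨D, hD, hmax⟩ := Finset.exists_max_image
    (Finset.univ.filter fun D : Finset V => D.card ≤ (traces G D).card) Finset.card
    ⟨∅, by simp⟩
  simp only [Finset.mem_filter, Finset.mem_univ, true_and] at hD hmax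
  rcases le_or_gt (Fintype.card V) (3 * D.card) with hlarge | hsmall
  · obtain ⟨E, hE, hcard⟩ := exists_isLocatingSet_card_add_card_traces (G := G) D
    exact ⟨E, hE, by omega⟩
  -- Otherwise `insert x D` would be a larger member of the family.
  have hinsert : ∀ x ∉ D, (traces G (insert x D)).card ≤ D.card := fun x hx => by
    by_contra! hlt
    have hc := Finset.card_insert_of_notMem hx
    have := hmax (insert x D) (by omega)
    omega
  by_cases hloc : Set.InjOn (fun v => D.filter (G.Adj v)) ((D : Set V)ᶜ)
  · exact ⟨D, isLocatingSet_of_injOn_filter_adj subset_rfl hloc, by omega⟩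
  have htr : (traces G D).card ≤ D.card := by
    simp only [Set.InjOn, not_forall] at hloc
    obtain ⟨x, hx, y, hy, hxy, hne⟩ := hloc
    exact (card_traces_le_card_traces_insert (by simpa using hy) hne hxy).trans
      (hinsert x (by simpa using hx))
  -- `S` collects the vertices whose trace is unique, so `D ∪ S` has at most twice as many elements
  -- as `D`.
  set S : Finset V := Dᶜ.filter fun v =>
    ∀ w ∉ D, D.filter (G.Adj v) = D.filter (G.Adj w) → v = w with hS
  have hScard : S.card ≤ (traces G D).card := by
    refine Finset.card_le_card_of_injOn (fun v => D.filter (G.Adj v)) (fun v hv => ?_)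
      (fun v hv w hw h => ?_)
    · exact Finset.mem_image_of_mem _ (Finset.mem_filter.1 hv).1
    · exact (Finset.mem_filter.1 hv).2 w
        (Finset.mem_compl.1 (Finset.mem_filter.1 hw).1) h
  refine ⟨D ∪ S, isLocatingSet_of_exists fun u v hu hv huv => ?_, ?_⟩
  · by_contra! hnone
    obtain ⟨x, hxu, hxv, hx⟩ := hG.exists_separating huv
    have hxDS : x ∉ D ∪ S := fun hmem => hx (hnone x hmem)
    simp only [Finset.mem_union, not_or] at hu hv hxDS
    have hxS := hxDS.2
    simp only [hS, Finset.mem_filter, Finset.mem_compl, hxDS.1, not_false_eq_true, true_and,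
      not_forall] at hxS
    obtain ⟨y, hy, hxy, hne⟩ := hxS
    -- The separator `x` shares its trace with `y`, so inserting it creates a trace beyond the
    -- `D.card` already there, against `hinsert`.
    have hlt := card_traces_lt_card_traces_insert hy hne hxy (u := u) (v := v)
      (by simp [hu.1, hxu.symm]) (by simp [hv.1, hxv.symm])
      (filter_adj_eq_iff.2 fun z hz => hnone z (Finset.mem_union_left _ hz)) hx
    have := hinsert x hxDS.1
    omega
  · have := Finset.card_union_le D S
    omega

end Locating

/-! ### Total domination by derandomized sampling. -/

section TotalDomination

open Finset

variable {V : Type u} [Fintype V] (G : SimpleGraph V) [DecidableRel G.Adj]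

/-- The multi-affine extension of `S ↦ |S| + |{v | v has no neighbor in S}|`. -/
def totalDominationCost (y : V → ℝ) : ℝ :=
  ∑ v, y v + ∑ v, ∏ w ∈ G.neighborFinset v, (1 - y w)

/-- Each product contains the factor at `a` at most once, so the cost is affine in every coordinate.
-/
theorem totalDominationCost_update [DecidableEq V] (y : V → ℝ) (a : V) (t : ℝ) :
    G.totalDominationCost (Function.update y a t) =
      t * G.totalDominationCost (Function.update y a 1) +
        (1 - t) * G.totalDominationCost (Function.update y a 0) := by
  have hsum : ∀ r : ℝ, ∑ v, Function.update y a r v = r + ∑ v ∈ univ \ {a}, y v := fun r =>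
    sum_update_of_mem (mem_univ a) y r
  have hprod : ∀ v, ∏ w ∈ G.neighborFinset v, (1 - Function.update y a t w) =
      t * ∏ w ∈ G.neighborFinset v, (1 - Function.update y a 1 w) +
        (1 - t) * ∏ w ∈ G.neighborFinset v, (1 - Function.update y a 0 w) := by
    intro v
    have hrest : ∀ (r : ℝ) (s : Finset V), a ∉ s →
        ∏ w ∈ s, (1 - Function.update y a r w) = ∏ w ∈ s, (1 - y w) := fun r s has =>
      prod_congr rfl fun w hw => by
        rw [Function.update_of_ne (ne_of_mem_of_not_mem hw has)]
    by_cases ha : a ∈ G.neighborFinset v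
    · simp only [← mul_prod_erase _ _ ha, Function.update_self,
        hrest _ _ (notMem_erase a (G.neighborFinset v))]
      ring
    · simp only [hrest _ _ ha]
      ring
  simp only [totalDominationCost, hsum, hprod, sum_add_distrib, ← mul_sum]
  ring

/-- Method of conditional expectations: the cost at `p` averages those at 0 and 1, so rounding
coordinates one by one need not increase it. -/
theorem exists_zero_one_totalDominationCost_le {p : ℝ} (hp0 : 0 ≤ p) (hp1 : p ≤ 1) :
    ∃ y : V → ℝ, (∀ v, y v = 0 ∨ y v = 1) ∧
      G.totalDominationCost y ≤ G.totalDominationCost fun _ => p := by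
  classical
  suffices h : ∀ s : Finset V, ∃ y : V → ℝ, (∀ v ∈ s, y v = 0 ∨ y v = 1) ∧
      (∀ v ∉ s, y v = p) ∧ G.totalDominationCost y ≤ G.totalDominationCost fun _ => p by
    obtain ⟨y, hy, -, hle⟩ := h univ
    exact ⟨y, fun v => hy v (mem_univ v), hle⟩
  intro s
  induction s using Finset.induction_on with
  | empty => exact ⟨fun _ => p, by simp, by simp, le_rfl⟩
  | insert a s ha ih =>
    obtain ⟨y, hy01, hyp, hle⟩ := ih
    have hupd : ∀ r : ℝ, (r = 0 ∨ r = 1) →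
        G.totalDominationCost (Function.update y a r) ≤ G.totalDominationCost y →
        ∃ y : V → ℝ, (∀ v ∈ insert a s, y v = 0 ∨ y v = 1) ∧
          (∀ v ∉ insert a s, y v = p) ∧
          G.totalDominationCost y ≤ G.totalDominationCost fun _ => p := by
      intro r hr hler
      refine ⟨Function.update y a r, fun v hv => ?_, fun v hv => ?_, hler.trans hle⟩
      · rcases eq_or_ne v a with rfl | hva
        · simpa using hr
        · rw [Function.update_of_ne hva]
          exact hy01 v ((mem_insert.1 hv).resolve_left hva)
      · rw [mem_insert, not_or] at hv
        rw [Function.update_of_ne hv.1]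
        exact hyp v hv.2
    have hconv := G.totalDominationCost_update y a p
    rw [show Function.update y a p = y by rw [← hyp a ha, Function.update_eq_self]] at hconv
    rcases le_total (G.totalDominationCost (Function.update y a 0))
      (G.totalDominationCost (Function.update y a 1)) with h | h
    · exact hupd 0 (Or.inl rfl) (by nlinarith)
    · exact hupd 1 (Or.inr rfl) (by nlinarith)

/-- At a 0-1 point the product indicates a vertex with no chosen neighbor; adding one neighbor for
each such vertex repairs the set. -/
theorem exists_isTotalDominatingSet_card_le_of_zero_one (h : G.HasNoIsolatedVertex) {y : V → ℝ}
    (hy : ∀ v, y v = 0 ∨ y v = 1) :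
    ∃ T : Finset V, G.IsTotalDominatingSet T ∧ (T.card : ℝ) ≤ G.totalDominationCost y := by
  classical
  choose g hg using h
  set S : Finset V := univ.filter fun v => y v = 1
  set U : Finset V := univ.filter fun v => ∀ w ∈ S, ¬ G.Adj v w
  have hS : (S.card : ℝ) = ∑ v, y v := by
    rw [card_filter, Nat.cast_sum]
    refine sum_congr rfl fun v _ => ?_
    rcases hy v with h | h <;> simp [h]
  have hU : (U.card : ℝ) ≤ ∑ v, ∏ w ∈ G.neighborFinset v, (1 - y w) := by
    rw [card_filter, Nat.cast_sum]
    refine sum_le_sum fun v _ => ?_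
    split_ifs with hv
    · rw [prod_eq_one]
      · simp
      intro w hw
      have : y w ≠ 1 := fun h1 => hv w (by simp [S, h1]) (by simpa using hw)
      simp [(hy w).resolve_right this]
    · push_cast
      exact prod_nonneg fun w _ => by rcases hy w with h | h <;> simp [h]
  refine ⟨S ∪ U.image g, fun v => ?_, ?_⟩
  · by_cases hv : v ∈ U
    · exact ⟨g v, mem_union_right _ (mem_image_of_mem g hv), hg v⟩
    · simp only [U, mem_filter, mem_univ, true_and, not_forall, not_not] at hv
      obtain ⟨w, hw, hvw⟩ := hv
      exact ⟨w, mem_union_left _ hw, hvw⟩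
  · have hcard : (S ∪ U.image g).card ≤ S.card + U.card :=
      (card_union_le _ _).trans (Nat.add_le_add_left card_image_le _)
    calc ((S ∪ U.image g).card : ℝ) ≤ S.card + U.card := by exact_mod_cast hcard
      _ ≤ _ := by rw [hS, totalDominationCost]; gcongr

theorem hasNoIsolatedVertex_of_one_le_minDegree (hδ : 1 ≤ G.minDegree) :
    G.HasNoIsolatedVertex := fun v =>
  (G.degree_pos_iff_exists_adj v).1 (hδ.trans (G.minDegree_le_degree v))

theorem exists_isTotalDominatingSet_card_le (hδ : 1 ≤ G.minDegree) :
    ∃ T : Finset V, G.IsTotalDominatingSet T ∧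
      (T.card : ℝ) ≤ (1 + Real.log G.minDegree) / G.minDegree * Fintype.card V := by
  set δ := G.minDegree with hδdef
  have hδ1 : (1 : ℝ) ≤ δ := by exact_mod_cast hδ
  have hδ0 : (0 : ℝ) < δ := by linarith
  -- This `p` minimizes `p + exp (-p * δ)`, a bound for the cost per vertex.
  set p : ℝ := Real.log δ / δ with hp
  have hp0 : 0 ≤ p := div_nonneg (Real.log_nonneg hδ1) hδ0.le
  have hp1 : p ≤ 1 := by
    rw [hp, div_le_one hδ0]
    linarith [Real.log_le_sub_one_of_pos hδ0]
  obtain ⟨y, hy, hle⟩ := G.exists_zero_one_totalDominationCost_le hp0 hp1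
  obtain ⟨T, hT, hTcard⟩ := G.exists_isTotalDominatingSet_card_le_of_zero_one
    (G.hasNoIsolatedVertex_of_one_le_minDegree hδ) hy
  refine ⟨T, hT, hTcard.trans (hle.trans ?_)⟩
  have hpow : (1 - p) ^ δ ≤ 1 / δ := by
    calc (1 - p) ^ δ ≤ Real.exp (-p) ^ δ :=
          pow_le_pow_left₀ (by linarith) (Real.one_sub_le_exp_neg p) δ
      _ = Real.exp (-Real.log δ) := by
          rw [← Real.exp_nat_mul, hp]
          congr 1
          field_simp
      _ = 1 / δ := by rw [Real.exp_neg, Real.exp_log hδ0, one_div]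
  have hterm : ∀ v, ∏ _w ∈ G.neighborFinset v, (1 - p) ≤ 1 / δ := fun v => by
    rw [prod_const, card_neighborFinset_eq_degree]
    exact (pow_le_pow_of_le_one (by linarith) (by linarith) (G.minDegree_le_degree v)).trans hpow
  calc G.totalDominationCost (fun _ => p)
      ≤ ∑ _v : V, p + ∑ _v : V, 1 / (δ : ℝ) :=
        add_le_add_right (sum_le_sum fun v _ => hterm v) _
    _ = (1 + Real.log δ) / δ * Fintype.card V := by
        simp only [sum_const, card_univ, nsmul_eq_mul, hp]
        ring

end TotalDomination

end SimpleGraph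

theorem corollary12 {V : Type u} [Fintype V] (G : SimpleGraph V) [DecidableRel G.Adj]
    (hG : G.IsTwinFree) (δ n : ℕ) (hδ : G.minDegree = δ) (hδ1 : 1 ≤ δ)
    (hn : Fintype.card V = n) :
    (G.locationTotalDominationNumber : ℝ) ≤
        ((2 : ℝ) / 3 + (1 + Real.log (δ : ℝ)) / (δ : ℝ)) * (n : ℝ) ∧
    (G.IsBipartite ∨ G.IsCoBipartite ∨ G.IsSplit →
      (G.locationTotalDominationNumber : ℝ) ≤
        ((1 : ℝ) / 2 + (1 + Real.log (δ : ℝ)) / (δ : ℝ)) * (n : ℝ)) ∧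
    (LocationDominationConjecture.{u} →
      (G.locationTotalDominationNumber : ℝ) ≤
        ((1 : ℝ) / 2 + (1 + Real.log (δ : ℝ)) / (δ : ℝ)) * (n : ℝ)) := by

  subst hδ hn
  obtain ⟨T, hT, hTcard⟩ := G.exists_isTotalDominatingSet_card_le hδ1
  have hbound : ∀ (c : ℝ) (D : Finset V), G.IsLocatingSet D →
      (D.card : ℝ) ≤ c * Fintype.card V →
      (G.locationTotalDominationNumber : ℝ) ≤
        (c + (1 + Real.log (G.minDegree : ℝ)) / (G.minDegree : ℝ)) * Fintype.card V := by
    intro c D hD hc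
    have hle : (G.locationTotalDominationNumber : ℝ) ≤ D.card + T.card := by
      exact_mod_cast hD.locationTotalDominationNumber_le hT
    rw [add_mul]
    linarith
  refine ⟨?_, fun h => ?_, fun hconj => ?_⟩
  · have : Nonempty V := by
      by_contra hempty
      rw [not_nonempty_iff] at hempty
      simp at hδ1
    obtain ⟨D, hD, hcard⟩ := hG.exists_isLocatingSet_three_mul_card_le
    have hcast : (3 : ℝ) * D.card ≤ 2 * Fintype.card V := by exact_mod_cast hcard
    exact hbound _ D hD (by linarith)
  · obtain ⟨D, hD, hcard⟩ := hG.exists_isLocatingSet_two_mul_card_le h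
    have hcast : (2 : ℝ) * D.card ≤ Fintype.card V := by exact_mod_cast hcard
    exact hbound _ D hD (by linarith)
  · obtain ⟨D, hD, hcard⟩ := G.exists_isLocatingDominatingSet_card_eq
    have hle := hconj V G hG (G.hasNoIsolatedVertex_of_one_le_minDegree hδ1)
    rw [← hcard] at hle
    exact hbound _ D hD.2 (by linarith)
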